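/- Let $d\ge 1$ be an integer and $1\le p\le\infty$ (with $1/\infty=0$). For a nondegenerate $d$-dimensional simplex $\mathcal T\subset\mathbb R^d$ (the convex hull of $d+1$ affinely independent points) with volume $|\mathcal T|$, and $Q(\mathbf x)=\sum_{j=1}^d x_j^2$, let $$E_p(\mathcal T)=\inf_{\mathbf a\in\mathbb R^d,\ c\in\mathbb R}\Big\|Q(\mathbf x)-\sum_{j=1}^d a_jx_j-c\Big\|_{L_p(\mathcal T)}$$ be the error of best $L_p$-approximation of $Q$ on $\mathcal T$ by affine functions. Let $\mathcal T_0\subset\mathbb R^d$ be a regular simplex of unit volume. Then $$\inf_{\mathcal T}\frac{E_p(\mathcal T)}{|\mathcal T|^{\frac 2d+\frac1p}}=\frac{E_p(\mathcal T_0)}{|\mathcal T_0|^{\frac 2d+\frac1p}},$$ where the infimum is over all nondegenerate simplices in $\mathbb R^d$. Equivalently, among simplices of unit volume, $$\inf_{|\mathcal T|=1}\frac{E_p(\mathcal T)}{|\mathcal T|^{1+\frac1p}}=\frac{E_p(\mathcal T_0)}{|\mathcal T_0|^{1+\frac1p}}.$$ -/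

import Mathlib

open MeasureTheory
open scoped ENNReal

noncomputable section

/-- Best approximation `E(f; H)` of `f` by the functions of `H` in the `L_p`-norm on `G`:
the infimum of `‖f - u‖_{L_p(G)}` over `u ∈ H`, with Lebesgue measure on `G`
(`eLpNorm` with `p = ∞` is the essential supremum). -/
def bestApprox {d : ℕ} (p : ℝ≥0∞) (G : Set (EuclideanSpace ℝ (Fin d)))
    (f : EuclideanSpace ℝ (Fin d) → ℝ) (H : Set (EuclideanSpace ℝ (Fin d) → ℝ)) : ℝ≥0∞ :=
  ⨅ u ∈ H, eLpNorm (fun x => f x - u x) p (volume.restrict G)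

/-- The affine functions `x ↦ ∑ j, a j * x j + c`. -/
def affineFunctions (d : ℕ) : Set (EuclideanSpace ℝ (Fin d) → ℝ) :=
  {g | ∃ (a : EuclideanSpace ℝ (Fin d)) (c : ℝ), ∀ x, g x = ∑ j, a j * x j + c}

/-- The quadratic function `Q(x) = ∑ j, x j ^ 2`. -/
def quadFun (d : ℕ) (x : EuclideanSpace ℝ (Fin d)) : ℝ := ∑ j, x j ^ 2

/-- A nondegenerate `d`-dimensional simplex in `ℝ^d`, given by its `d + 1` affinely
independent vertices. -/
abbrev FullSimplex (d : ℕ) := Affine.Simplex ℝ (EuclideanSpace ℝ (Fin d)) d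

/-- The solid simplex, as a subset of `ℝ^d`. -/
def FullSimplex.body {d : ℕ} (T : FullSimplex d) : Set (EuclideanSpace ℝ (Fin d)) :=
  convexHull ℝ (Set.range T.points)

/-- The `d`-dimensional volume `|T|`. -/
def FullSimplex.vol {d : ℕ} (T : FullSimplex d) : ℝ≥0∞ := volume T.body

/-- The error of best `L_p`-approximation of `Q` by affine functions on the simplex `T`. -/
def FullSimplex.error {d : ℕ} (p : ℝ≥0∞) (T : FullSimplex d) : ℝ≥0∞ :=
  bestApprox p T.body (quadFun d) (affineFunctions d)

/-- The best-approximation error on `T` divided by `|T| ^ (s + 1/p)`, where `1/∞ = 0`. -/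
def FullSimplex.normalizedError {d : ℕ} (p : ℝ≥0∞) (s : ℝ) (T : FullSimplex d) : ℝ≥0∞ :=
  T.error p / T.vol ^ (s + (p⁻¹).toReal)

end

/-! Let `φ` be the affine map carrying the regular simplex `T₀` onto `T`. For any affine `A`, pull
`Q - A` back by `φ` and sum over the `(d + 1)!` symmetries of `T₀`. The result is `m * Q` minus an
affine function (`sum_perm_quadFun_sub_lift`), with `L_p` norm at least `m` times the error on `T₀`.
By Minkowski it is at most `(d + 1)!` times the norm of the pull-back, as symmetries preserve
volume. AM-GM on the eigenvalues of `L ∘ L.adjoint`, `L` the linear part of `φ`, gives `m ≥ (d + 1)!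
* |det L| ^ (2 / d)`, and `|det L| = |T|` when `|T₀| = 1`. -/

section InnerProduct

open scoped InnerProductSpace

variable {E : Type*} [NormedAddCommGroup E] [InnerProductSpace ℝ E]

/-- In barycentric coordinates, `Q` is an affine part plus a quadratic part seeing only edge
lengths. -/
theorem norm_sq_sum_smul_eq {ι : Type*} [Fintype ι] (c : ι → ℝ) (hc : ∑ i, c i = 1) (v : ι → E) :
    ‖∑ i, c i • v i‖ ^ 2 =
      ∑ i, c i * ‖v i‖ ^ 2 - (∑ i, ∑ j, c i * c j * ‖v i - v j‖ ^ 2) / 2 := by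
  have h1 : ‖∑ i, c i • v i‖ ^ 2 = ∑ i, ∑ j, c i * c j * ⟪v i, v j⟫_ℝ := by
    rw [← real_inner_self_eq_norm_sq, sum_inner]
    refine Finset.sum_congr rfl fun i _ => ?_
    rw [inner_sum]
    refine Finset.sum_congr rfl fun j _ => ?_
    rw [real_inner_smul_left, real_inner_smul_right, mul_assoc]
  have h2 : ∑ i, ∑ j, c i * c j * ‖v i - v j‖ ^ 2 =
      ∑ i, ∑ j, (c j * (c i * ‖v i‖ ^ 2)) + ∑ i, ∑ j, c i * (c j * ‖v j‖ ^ 2)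
        - 2 * ∑ i, ∑ j, c i * c j * ⟪v i, v j⟫_ℝ := by
    simp only [Finset.mul_sum, ← Finset.sum_add_distrib, ← Finset.sum_sub_distrib]
    refine Finset.sum_congr rfl fun i _ => Finset.sum_congr rfl fun j _ => ?_
    rw [norm_sub_sq_real]
    ring
  simp only [← Finset.sum_mul, ← Finset.mul_sum, hc, one_mul] at h2
  rw [h1, h2]
  ring

variable [FiniteDimensional ℝ E]

theorem LinearMap.det_adjoint_real (L : E →ₗ[ℝ] E) : L.adjoint.det = L.det := by
  let b := stdOrthonormalBasis ℝ E
  rw [← LinearMap.det_toMatrix b.toBasis, ← LinearMap.det_toMatrix b.toBasis,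
    LinearMap.toMatrix_adjoint b b L]
  simp

/-- The AM-GM inequality between determinant and Hilbert-Schmidt norm. -/
theorem abs_det_rpow_le {d : ℕ} (hd : 1 ≤ d) (hE : Module.finrank ℝ E = d)
    (b : OrthonormalBasis (Fin d) ℝ E) (L : E →ₗ[ℝ] E) :
    |L.det| ^ (2 / (d : ℝ)) ≤ (∑ k, ‖L.adjoint (b k)‖ ^ 2) / d := by
  -- The eigenvalues of `L ∘ₗ L.adjoint` are nonnegative, with sum the squared Hilbert-Schmidt norm
  -- and product `L.det ^ 2`.
  have hpos : (L ∘ₗ L.adjoint).IsPositive := L.isPositive_self_comp_adjoint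
  have hsym := hpos.isSymmetric
  have hnn := hpos.nonneg_eigenvalues hE
  have hd' : (d : ℝ) ≠ 0 := by positivity
  have htr : ∑ k, ‖L.adjoint (b k)‖ ^ 2 = ∑ i, hsym.eigenvalues hE i := by
    have := hsym.trace_eq_sum_eigenvalues hE
    rw [LinearMap.trace_eq_sum_inner _ b] at this
    refine Eq.trans (Finset.sum_congr rfl fun k _ => ?_) this
    rw [LinearMap.comp_apply, ← LinearMap.adjoint_inner_left, real_inner_self_eq_norm_sq]
  have hdet : |L.det| ^ 2 = ∏ i, hsym.eigenvalues hE i := by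
    have := hsym.det_eq_prod_eigenvalues hE
    rw [LinearMap.det_comp, LinearMap.det_adjoint_real] at this
    rw [sq_abs, sq]
    simpa using this
  have := Real.geom_mean_le_arith_mean Finset.univ (fun _ => (1 : ℝ)) (hsym.eigenvalues hE)
    (fun _ _ => zero_le_one) (by simp; omega) (fun i _ => hnn i)
  simp only [Real.rpow_one, one_mul, Finset.sum_const, Finset.card_univ, Fintype.card_fin,
    nsmul_eq_mul, mul_one] at this
  rw [htr]
  refine le_trans (le_of_eq ?_) this
  rw [← hdet, ← Real.rpow_natCast, ← Real.rpow_mul (abs_nonneg _)]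
  rfl

end InnerProduct

/-! ### Averaging over the symmetric group -/

section Symmetrization

/-- The symmetric group is 2-transitive, so all off-diagonal sums agree; adding them over all
ordered pairs determines `K`. -/
theorem exists_sum_perm_eq {ι : Type*} [Fintype ι] [DecidableEq ι] (f : ι → ι → ℝ)
    (hf : ∀ i, f i i = 0) :
    ∃ K : ℝ, (∀ i j, ∑ σ : Equiv.Perm ι, f (σ i) (σ j) = if i = j then 0 else K) ∧
      (Fintype.card ι * (Fintype.card ι - 1) : ℝ) * K =
        (Fintype.card ι).factorial * ∑ i, ∑ j, f i j := by
  have hex : ∃ K : ℝ, ∀ i j, ∑ σ : Equiv.Perm ι, f (σ i) (σ j) = if i = j then 0 else K := by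
    by_cases h : ∃ k l : ι, k ≠ l
    · obtain ⟨k, l, hkl⟩ := h
      refine ⟨∑ σ : Equiv.Perm ι, f (σ k) (σ l), fun i j => ?_⟩
      split_ifs with hij
      · simp [hij, hf]
      · obtain ⟨τ, h1, h2⟩ := MulAction.is_two_pretransitive_iff.1
          (Equiv.Perm.isMultiplyPretransitive ι 2) hkl hij
        rw [Equiv.Perm.smul_def] at h1 h2
        rw [← Equiv.sum_comp (Equiv.mulRight τ) fun σ : Equiv.Perm ι => f (σ k) (σ l)]
        simp [h1, h2]
    · push Not at h
      exact ⟨0, fun i j => by simp [h i j, hf]⟩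
  obtain ⟨K, hK⟩ := hex
  refine ⟨K, hK, ?_⟩
  have h1 : ∑ i, ∑ j, ∑ σ : Equiv.Perm ι, f (σ i) (σ j) =
      (Fintype.card ι).factorial * ∑ i, ∑ j, f i j := by
    have : ∀ σ : Equiv.Perm ι, ∑ i, ∑ j, f (σ i) (σ j) = ∑ i, ∑ j, f i j := fun σ => by
      rw [Equiv.sum_comp σ (fun i => ∑ j, f i (σ j))]
      exact Finset.sum_congr rfl fun i _ => Equiv.sum_comp σ (fun j => f i j)
    simp_rw [Finset.sum_comm (t := (Finset.univ : Finset (Equiv.Perm ι)))]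
    simp [this, Fintype.card_perm]
  rw [← h1]
  simp_rw [hK]
  have h2 : ∀ i j : ι, (if i = j then 0 else K) = K - if i = j then K else 0 := by
    intro i j; split_ifs <;> simp
  simp only [h2, Finset.sum_sub_distrib, Finset.sum_const, Finset.card_univ, nsmul_eq_mul,
    Finset.sum_ite_eq, Finset.mem_univ, if_true]
  ring

end Symmetrization

/-! ### Tight frames from equilateral simplices -/

section Frame

open scoped InnerProductSpace

variable {E : Type*} [NormedAddCommGroup E] [InnerProductSpace ℝ E] {ι : Type*} [Fintype ι]

/-- The edges of an equilateral simplex form a tight frame. -/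
theorem AffineBasis.sum_inner_sub_sq (b : AffineBasis ι ℝ E) (r : ℝ)
    (hr : ∀ i j, i ≠ j → dist (b i) (b j) = r) (y : E) :
    ∑ i, ∑ j, ⟪b i - b j, y⟫_ℝ ^ 2 = Fintype.card ι * r ^ 2 * ‖y‖ ^ 2 := by
  classical
  have hsq : ∀ i j, ‖b i - b j‖ ^ 2 = if i = j then 0 else r ^ 2 := fun i j => by
    split_ifs with h
    · simp [h]
    · rw [← dist_eq_norm, hr i j h]
  have hinner : ∀ i j k l, ⟪b i - b j, b k - b l⟫_ℝ =
      (‖b i - b l‖ ^ 2 + ‖b j - b k‖ ^ 2 - ‖b i - b k‖ ^ 2 - ‖b j - b l‖ ^ 2) / 2 := by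
    intro i j k l
    simp only [norm_sub_sq_real, inner_sub_left, inner_sub_right]
    ring
  obtain ⟨o⟩ := b.nonempty
  -- The frame operator; it is scalar because it is so on the basis of edges issuing from `o`, where
  -- polarization (`hinner`) leaves only distances.
  let M : E →ₗ[ℝ] E := ∑ i, ∑ j, (innerₗ E (b i - b j)).smulRight (b i - b j)
  have hM : ∀ z, M z = ∑ i, ∑ j, ⟪b i - b j, z⟫_ℝ • (b i - b j) := fun z => by
    simp only [M, LinearMap.sum_apply, LinearMap.smulRight_apply, innerₗ_apply_apply]
  have hMeq : M = (Fintype.card ι * r ^ 2 : ℝ) • LinearMap.id := by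
    refine (b.basisOf o).ext fun ⟨k, hk⟩ => ?_
    rw [hM, AffineBasis.basisOf_apply]
    simp only [vsub_eq_sub, hinner, hsq, LinearMap.smul_apply, LinearMap.id_apply]
    have : ∀ i j, (((if i = o then 0 else r ^ 2) + (if j = k then 0 else r ^ 2)
        - (if i = k then 0 else r ^ 2) - (if j = o then 0 else r ^ 2)) / 2 : ℝ) • (b i - b j) =
        (r ^ 2 / 2) • ((if i = k then b k - b j else 0) - (if i = o then b o - b j else 0)
          - (if j = k then b i - b k else 0) + (if j = o then b i - b o else 0)) := by
      intro i j
      split_ifs <;> subst_vars <;> module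
    simp only [this, ← Finset.smul_sum, Finset.sum_add_distrib, Finset.sum_sub_distrib,
      Finset.sum_ite_eq', Finset.mem_univ, if_true]
    have hcomm : ∀ a : ι, ∑ i, ∑ j, (if i = a then b a - b j else 0) =
        ∑ j, (b a - b j) := fun a => by
      rw [Finset.sum_comm]; simp
    rw [hcomm, hcomm]
    simp only [Finset.sum_sub_distrib, Finset.sum_const, Finset.card_univ, ← Nat.cast_smul_eq_nsmul ℝ]
    module
  have : ∑ i, ∑ j, ⟪b i - b j, y⟫_ℝ ^ 2 = ⟪M y, y⟫_ℝ := by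
    simp only [hM, sum_inner, real_inner_smul_left, sq]
  rw [this, hMeq]
  simp [real_inner_smul_left]

/-- Sums the frame identity over the vectors `L.adjoint (e k)`: the edge lengths of the image
simplex determine the Hilbert-Schmidt norm of `L`. -/
theorem AffineBasis.sum_norm_sq_map_sub [FiniteDimensional ℝ E] {κ : Type*} [Fintype κ]
    (b : AffineBasis ι ℝ E) (r : ℝ) (hr : ∀ i j, i ≠ j → dist (b i) (b j) = r)
    (e : OrthonormalBasis κ ℝ E) (L : E →ₗ[ℝ] E) :
    ∑ i, ∑ j, ‖L (b i - b j)‖ ^ 2 =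
      Fintype.card ι * r ^ 2 * ∑ k, ‖L.adjoint (e k)‖ ^ 2 := by
  have h : ∀ x, ‖L x‖ ^ 2 = ∑ k, ⟪x, L.adjoint (e k)⟫_ℝ ^ 2 := fun x => by
    rw [← e.sum_sq_norm_inner_left]
    simp [LinearMap.adjoint_inner_right]
  simp_rw [h, Finset.mul_sum, ← b.sum_inner_sub_sq r hr]
  rw [Finset.sum_comm (s := (Finset.univ : Finset κ))]
  exact Finset.sum_congr rfl fun i _ => Finset.sum_comm

end Frame

/-! ### Affine changes of variables in `L_p` -/

section ChangeOfVariables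

variable {E : Type*} [NormedAddCommGroup E] [NormedSpace ℝ E] [FiniteDimensional ℝ E]
  [MeasurableSpace E] [BorelSpace E] (μ : Measure E) [μ.IsAddHaarMeasure]

theorem AffineMap.measure_image (φ : E →ᵃ[ℝ] E) (S : Set E) :
    μ (φ '' S) = ENNReal.ofReal |φ.linear.det| * μ S := by
  have : φ '' S = (fun x => x + φ 0) '' (φ.linear '' S) := by
    rw [Set.image_image]
    exact Set.image_congr fun x _ => congrFun φ.decomp x
  rw [this, Set.image_add_right, measure_preimage_add_right, Measure.addHaar_image_linearMap]

theorem AffineMap.eLpNorm_restrict_image (φ : E →ᵃ[ℝ] E) (hφ : φ.linear.det ≠ 0) (p : ℝ≥0∞)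
    (f : E → ℝ) (S : Set E) :
    eLpNorm f p (μ.restrict (φ '' S)) =
      ENNReal.ofReal |φ.linear.det| ^ (p⁻¹).toReal * eLpNorm (f ∘ φ) p (μ.restrict S) := by
  let e := (φ.linear.equivOfDetNeZero hφ).toContinuousLinearEquiv.toHomeomorph.toMeasurableEquiv
  have hdecomp : (φ : E → E) = (MeasurableEquiv.addRight (φ 0)) ∘ e := φ.decomp
  have hemb : MeasurableEmbedding φ := by
    rw [hdecomp]
    exact (MeasurableEquiv.measurableEmbedding _).comp e.measurableEmbedding
  have hmap : μ.map φ = ENNReal.ofReal |(φ.linear.det)⁻¹| • μ := by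
    rw [hdecomp, ← Measure.map_map (MeasurableEquiv.measurable _) e.measurable]
    have : μ.map e = ENNReal.ofReal |(φ.linear.det)⁻¹| • μ :=
      Measure.map_linearMap_addHaar_eq_smul_addHaar μ hφ
    rw [this, Measure.map_smul]
    congr 1
    exact map_add_right_eq_self μ (φ 0)
  have hpos : (0 : ℝ) < |φ.linear.det| := abs_pos.2 hφ
  have h1 : (μ.restrict S).map φ =
      ENNReal.ofReal |(φ.linear.det)⁻¹| • μ.restrict (φ '' S) := by
    rw [← Measure.restrict_smul, ← hmap, hemb.restrict_map,
      Set.preimage_image_eq _ hemb.injective]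
  rw [← hemb.eLpNorm_map_measure, h1, eLpNorm_smul_measure_of_ne_zero (by simpa using hφ),
    smul_eq_mul, ← mul_assoc, one_div, ← ENNReal.mul_rpow_of_nonneg _ _ ENNReal.toReal_nonneg,
    ← ENNReal.ofReal_mul hpos.le, abs_inv, mul_inv_cancel₀ hpos.ne']
  simp

end ChangeOfVariables

/-! ### Affine maps prescribed on vertices -/

section AffineOfVertices

variable {ι V W W' : Type*} [Fintype ι] [AddCommGroup V] [Module ℝ V] [AddCommGroup W] [Module ℝ W]
  [AddCommGroup W'] [Module ℝ W']

/-- The affine map sending the points of an affine basis to prescribed points. -/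
noncomputable def AffineBasis.lift (b : AffineBasis ι ℝ V) (v : ι → W) : V →ᵃ[ℝ] W where
  toFun x := ∑ i, b.coord i x • v i
  linear := ∑ i, (b.coord i).linear.smulRight (v i)
  map_vadd' p w := by
    simp only [AffineMap.map_vadd]
    simp only [vadd_eq_add, add_smul, Finset.sum_add_distrib, LinearMap.sum_apply,
      LinearMap.smulRight_apply]

theorem AffineBasis.lift_apply (b : AffineBasis ι ℝ V) (v : ι → W) (x : V) :
    b.lift v x = ∑ i, b.coord i x • v i := rfl

@[simp]
theorem AffineBasis.lift_apply_self (b : AffineBasis ι ℝ V) (v : ι → W) (i : ι) :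
    b.lift v (b i) = v i := by
  classical
  simp [AffineBasis.lift_apply, AffineBasis.coord_apply]

theorem AffineBasis.map_lift (b : AffineBasis ι ℝ V) (A : W →ᵃ[ℝ] W') (v : ι → W) (x : V) :
    A (b.lift v x) = b.lift (A ∘ v) x := by
  have : A.comp (b.lift v) = b.lift (A ∘ v) := by
    refine AffineMap.ext_on b.tot ?_
    rintro _ ⟨i, rfl⟩
    simp
  exact DFunLike.congr_fun this x

/-- Precomposing with a symmetry of the simplex only relabels the target vertices. -/
theorem AffineBasis.lift_lift_perm (b : AffineBasis ι ℝ V) (v : ι → W)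
    (σ : Equiv.Perm ι) (x : V) :
    b.lift v (b.lift (b ∘ σ) x) = b.lift (v ∘ σ) x := by
  rw [b.map_lift]
  congr 2
  ext i
  simp

theorem AffineBasis.lift_image_convexHull (b : AffineBasis ι ℝ V) (v : ι → W) :
    b.lift v '' convexHull ℝ (Set.range b) = convexHull ℝ (Set.range v) := by
  rw [AffineMap.image_convexHull, ← Set.range_comp]
  congr 2
  ext i
  simp

end AffineOfVertices

/-! ### The symmetrized quadratic function -/

theorem mem_affineFunctions_iff {d : ℕ} {g : EuclideanSpace ℝ (Fin d) → ℝ} :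
    g ∈ affineFunctions d ↔ ∃ A : EuclideanSpace ℝ (Fin d) →ᵃ[ℝ] ℝ, ⇑A = g := by
  constructor
  · rintro ⟨a, c, h⟩
    refine ⟨(innerₗ _ a).toAffineMap + AffineMap.const ℝ _ c, ?_⟩
    ext x
    simp [h, PiLp.inner_apply, mul_comm]
  · rintro ⟨A, rfl⟩
    refine ⟨(InnerProductSpace.toDual ℝ _).symm (LinearMap.toContinuousLinearMap A.linear), A 0,
      fun x => ?_⟩
    have h := InnerProductSpace.toDual_symm_apply (𝕜 := ℝ) (x := x)
      (y := LinearMap.toContinuousLinearMap A.linear)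
    rw [congrFun A.decomp x, Pi.add_apply]
    rw [PiLp.inner_apply] at h
    simp only [RCLike.inner_apply, conj_trivial, LinearMap.coe_toContinuousLinearMap'] at h
    rw [← h]
    simp [mul_comm]

theorem quadFun_eq_norm_sq {d : ℕ} (x : EuclideanSpace ℝ (Fin d)) : quadFun d x = ‖x‖ ^ 2 := by
  simp [quadFun, EuclideanSpace.norm_sq_eq]

/-- Averaging the pull-back of the quadratic function over the symmetries of an equilateral simplex
gives a multiple of the quadratic function, up to an affine function. -/
theorem sum_perm_quadFun_sub_lift {d : ℕ} {ι : Type*} [Fintype ι] [DecidableEq ι]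
    (hι : Fintype.card ι = d + 1) (hd : 1 ≤ d)
    (b : AffineBasis ι ℝ (EuclideanSpace ℝ (Fin d))) (r : ℝ) (hr0 : r ≠ 0)
    (hr : ∀ i j, i ≠ j → dist (b i) (b j) = r)
    (v : ι → EuclideanSpace ℝ (Fin d)) (A : EuclideanSpace ℝ (Fin d) →ᵃ[ℝ] ℝ) :
    ∃ m : ℝ, ∃ A' : EuclideanSpace ℝ (Fin d) →ᵃ[ℝ] ℝ,
      (∀ x, ∑ σ : Equiv.Perm ι,
        (quadFun d (b.lift v (b.lift (b ∘ σ) x)) - A (b.lift v (b.lift (b ∘ σ) x))) =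
          m * quadFun d x - A' x) ∧
      (d + 1).factorial * |(b.lift v).linear.det| ^ (2 / (d : ℝ)) ≤ m := by
  obtain ⟨K, hK, hKsum⟩ := exists_sum_perm_eq (fun i j => ‖v i - v j‖ ^ 2) (by simp)
  -- `K / r ^ 2` matches the quadratic parts; evaluating at each vertex `b i` then forces the affine
  -- remainder.
  refine ⟨K / r ^ 2, b.lift fun i => K / r ^ 2 * ‖b i‖ ^ 2 -
    (∑ σ : Equiv.Perm ι, ‖v (σ i)‖ ^ 2) + ∑ σ : Equiv.Perm ι, A (v (σ i)), fun x => ?_, ?_⟩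
  · have hc := b.sum_coord_apply_eq_one x
    set c := fun i => b.coord i x
    have hsq : ∀ i j, ‖b i - b j‖ ^ 2 = r ^ 2 * if i = j then 0 else 1 := fun i j => by
      split_ifs with h
      · simp [h]
      · rw [← dist_eq_norm, hr i j h, mul_one]
    have hQ : quadFun d x = ∑ i, c i * ‖b i‖ ^ 2
        - r ^ 2 * (∑ i, ∑ j, c i * c j * if i = j then 0 else 1) / 2 := by
      have := norm_sq_sum_smul_eq c hc b
      rw [b.linear_combination_coord_eq_self] at this
      rw [quadFun_eq_norm_sq, this]
      simp only [hsq, Finset.mul_sum]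
      simp only [mul_left_comm]
    have hS : ∑ σ : Equiv.Perm ι, ∑ i, ∑ j, c i * c j * ‖v (σ i) - v (σ j)‖ ^ 2 =
        K * ∑ i, ∑ j, c i * c j * if i = j then 0 else 1 := by
      rw [Finset.sum_comm, Finset.mul_sum]
      refine Finset.sum_congr rfl fun i _ => ?_
      rw [Finset.sum_comm, Finset.mul_sum]
      refine Finset.sum_congr rfl fun j _ => ?_
      rw [← Finset.mul_sum, hK]
      split_ifs <;> ring
    have hσ : ∀ σ : Equiv.Perm ι, quadFun d (b.lift v (b.lift (b ∘ σ) x))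
        - A (b.lift v (b.lift (b ∘ σ) x)) = ∑ i, c i * ‖v (σ i)‖ ^ 2
          - (∑ i, ∑ j, c i * c j * ‖v (σ i) - v (σ j)‖ ^ 2) / 2 - ∑ i, c i * A (v (σ i)) := by
      intro σ
      rw [b.lift_lift_perm, b.map_lift, quadFun_eq_norm_sq, b.lift_apply, b.lift_apply,
        norm_sq_sum_smul_eq c hc]
      rfl
    simp only [hσ]
    rw [Finset.sum_sub_distrib, Finset.sum_sub_distrib, ← Finset.sum_div, hS, hQ, b.lift_apply]
    simp only [smul_eq_mul, mul_add, mul_sub, Finset.sum_add_distrib, Finset.sum_sub_distrib]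
    rw [Finset.sum_comm, Finset.sum_comm (f := fun (σ : Equiv.Perm ι) i => c i * A (v (σ i)))]
    simp only [← Finset.mul_sum, mul_left_comm _ (K / r ^ 2)]
    change _ = K / r ^ 2 * _ - _ - (K / r ^ 2 * _ - _ + _)
    field_simp
    ring
  -- The edge sum `h2` and the count `hKsum` give `m = (d + 1)! * (∑ k, ‖L.adjoint (e k)‖ ^ 2) / d`,
  -- to which AM-GM applies.
  · let e := EuclideanSpace.basisFun (Fin d) ℝ
    have h1 := abs_det_rpow_le hd (by simp) e (b.lift v).linear
    have h2 := b.sum_norm_sq_map_sub r hr e (b.lift v).linear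
    have h3 : ∀ i j, (b.lift v).linear (b i - b j) = v i - v j := fun i j => by
      rw [← vsub_eq_sub, AffineMap.linearMap_vsub]
      simp
    simp only [h3] at h2
    rw [h2, hι] at hKsum
    refine (mul_le_mul_of_nonneg_left h1 (by positivity)).trans (le_of_eq ?_)
    have hd' : (d : ℝ) ≠ 0 := by positivity
    have hd1 : (d : ℝ) + 1 ≠ 0 := by positivity
    push_cast at hKsum
    field_simp
    apply mul_left_cancel₀ hd1
    linear_combination -hKsum

theorem measurable_quadFun (d : ℕ) : Measurable (quadFun d) := by
  unfold quadFun
  fun_prop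

/-! ### Comparison of errors on simplices -/

namespace FullSimplex

variable {d : ℕ}

/-- The vertices of a full-dimensional simplex, as an affine basis. -/
def affineBasis (T : FullSimplex d) : AffineBasis (Fin (d + 1)) ℝ (EuclideanSpace ℝ (Fin d)) :=
  ⟨T.points, T.independent, by
    rw [T.independent.affineSpan_eq_top_iff_card_eq_finrank_add_one]
    simp⟩

theorem vol_ne_zero (T : FullSimplex d) : T.vol ≠ 0 := by
  have h : (interior T.body).Nonempty :=
    interior_convexHull_nonempty_iff_affineSpan_eq_top.2 T.affineBasis.tot
  exact ((isOpen_interior.measure_pos volume h).trans_le (measure_mono interior_subset)).ne'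

theorem vol_ne_top (T : FullSimplex d) : T.vol ≠ ∞ :=
  ((Set.finite_range T.points).isCompact_convexHull ℝ).measure_lt_top.ne

theorem image_lift_body (T₀ : FullSimplex d) (v : Fin (d + 1) → EuclideanSpace ℝ (Fin d)) :
    T₀.affineBasis.lift v '' T₀.body = convexHull ℝ (Set.range v) :=
  T₀.affineBasis.lift_image_convexHull v

/-- The lower bound for the best approximation error in terms of the regular simplex. -/
theorem vol_rpow_mul_error_le (hd : 1 ≤ d) {p : ℝ≥0∞} (hp : 1 ≤ p) (T₀ T : FullSimplex d)
    (heq : T₀.Equilateral) (hvol : T₀.vol = 1) :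
    T.vol ^ (2 / (d : ℝ) + (p⁻¹).toReal) * T₀.error p ≤ T.error p := by
  obtain ⟨r, hr⟩ := heq
  have hr0 : r ≠ 0 := by
    have h01 : (0 : Fin (d + 1)) ≠ Fin.last d := by
      rw [Ne, Fin.ext_iff]; simp; omega
    rw [← hr _ _ h01]
    exact dist_ne_zero.2 (T₀.independent.injective.ne h01)
  set b := T₀.affineBasis
  have hvolT : T.vol = ENNReal.ofReal |(b.lift T.points).linear.det| := by
    have := AffineMap.measure_image volume (b.lift T.points) T₀.body
    rw [image_lift_body] at this
    change T.vol = _ * T₀.vol at this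
    rwa [hvol, mul_one] at this
  have hdet : (b.lift T.points).linear.det ≠ 0 := fun h => T.vol_ne_zero (by simp [hvolT, h])
  -- A vertex permutation maps `T₀` onto itself, so it preserves volume.
  have hperm : ∀ σ : Equiv.Perm (Fin (d + 1)), |(b.lift (b ∘ σ)).linear.det| = 1 := by
    intro σ
    have := AffineMap.measure_image volume (b.lift (b ∘ σ)) T₀.body
    rw [image_lift_body, σ.surjective.range_comp] at this
    change T₀.vol = _ * T₀.vol at this
    rw [hvol, mul_one] at this
    simpa using this.symm
  refine le_iInf₂ fun u hu => ?_
  obtain ⟨A, rfl⟩ := mem_affineFunctions_iff.1 hu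
  obtain ⟨m, A', hsum, hm⟩ :=
    sum_perm_quadFun_sub_lift (by simp) hd b r hr0 hr T.points A
  have hm0 : 0 < m := lt_of_lt_of_le
    (mul_pos (by positivity) (Real.rpow_pos_of_pos (abs_pos.2 hdet) _)) hm
  set g : EuclideanSpace ℝ (Fin d) → ℝ := fun x => quadFun d x - A x
  have hgm : Measurable g :=
    (measurable_quadFun d).sub A.continuous_of_finiteDimensional.measurable
  have hlift : ∀ v : Fin (d + 1) → EuclideanSpace ℝ (Fin d), Measurable (b.lift v) := fun v =>
    (b.lift v).continuous_of_finiteDimensional.measurable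
  set G := g ∘ b.lift T.points
  have hT : eLpNorm g p (volume.restrict T.body) =
      T.vol ^ (p⁻¹).toReal * eLpNorm G p (volume.restrict T₀.body) := by
    rw [hvolT, ← AffineMap.eLpNorm_restrict_image volume _ hdet, image_lift_body]
    rfl
  have hGσ : ∀ σ : Equiv.Perm (Fin (d + 1)),
      eLpNorm (G ∘ b.lift (b ∘ σ)) p (volume.restrict T₀.body) =
        eLpNorm G p (volume.restrict T₀.body) := by
    intro σ
    have := AffineMap.eLpNorm_restrict_image volume (b.lift (b ∘ σ))
      (by rw [← abs_ne_zero, hperm]; simp) p G T₀.body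
    rw [image_lift_body, σ.surjective.range_comp, hperm] at this
    rw [ENNReal.ofReal_one, ENNReal.one_rpow, one_mul] at this
    exact this.symm
  have hupper : eLpNorm (∑ σ : Equiv.Perm (Fin (d + 1)), G ∘ b.lift (b ∘ σ)) p
      (volume.restrict T₀.body) ≤
        (d + 1).factorial * eLpNorm G p (volume.restrict T₀.body) := by
    refine (eLpNorm_sum_le (fun σ _ => ?_) hp).trans (le_of_eq ?_)
    · exact ((hgm.comp (hlift _)).comp (hlift _)).aestronglyMeasurable
    · simp [hGσ, Fintype.card_perm]
  -- Since `m > 0`, the affine function `m⁻¹ • A'` is a competitor for the error on `T₀`.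
  have hlower : ENNReal.ofReal m * T₀.error p ≤
      eLpNorm (∑ σ : Equiv.Perm (Fin (d + 1)), G ∘ b.lift (b ∘ σ)) p
        (volume.restrict T₀.body) := by
    have heq : (∑ σ : Equiv.Perm (Fin (d + 1)), G ∘ b.lift (b ∘ σ)) =
        m • fun x => quadFun d x - (m⁻¹ • A') x := by
      ext x
      rw [Finset.sum_apply]
      refine (hsum x).trans ?_
      simp only [Pi.smul_apply, smul_eq_mul, AffineMap.coe_smul]
      field_simp
    rw [heq, eLpNorm_const_smul, Real.enorm_of_nonneg hm0.le]
    gcongr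
    exact iInf₂_le _ (mem_affineFunctions_iff.2 ⟨_, rfl⟩)
  have hfac : ENNReal.ofReal m ≥ (d + 1).factorial * T.vol ^ (2 / (d : ℝ)) := by
    rw [hvolT, ENNReal.ofReal_rpow_of_pos (abs_pos.2 hdet), ← ENNReal.ofReal_natCast,
      ← ENNReal.ofReal_mul (by positivity)]
    exact ENNReal.ofReal_le_ofReal hm
  have key : T.vol ^ (2 / (d : ℝ)) * T₀.error p ≤ eLpNorm G p (volume.restrict T₀.body) := by
    have hN : ((d + 1).factorial : ℝ≥0∞) ≠ 0 := by exact_mod_cast Nat.factorial_ne_zero _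
    refine (ENNReal.mul_le_mul_iff_right hN (ENNReal.natCast_ne_top _)).1 ?_
    rw [← mul_assoc]
    exact (mul_le_mul_left hfac _).trans (hlower.trans hupper)
  change _ ≤ eLpNorm g p _
  rw [hT, ENNReal.rpow_add _ _ T.vol_ne_zero T.vol_ne_top, mul_comm (T.vol ^ _), mul_assoc]
  gcongr

theorem error_le_normalizedError (hd : 1 ≤ d) {p : ℝ≥0∞} (hp : 1 ≤ p) (T₀ T : FullSimplex d)
    (heq : T₀.Equilateral) (hvol : T₀.vol = 1) :
    T₀.error p ≤ T.normalizedError p (2 / (d : ℝ)) := by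
  unfold normalizedError
  rw [ENNReal.le_div_iff_mul_le (.inl ?_) (.inl ?_), mul_comm]
  · exact vol_rpow_mul_error_le hd hp T₀ T heq hvol
  · simp [ENNReal.rpow_eq_zero_iff, T.vol_ne_zero, T.vol_ne_top]
  · exact ENNReal.rpow_ne_top_of_ne_zero T.vol_ne_zero T.vol_ne_top

theorem normalizedError_of_vol_eq_one {T : FullSimplex d} (h : T.vol = 1) (p : ℝ≥0∞) (s : ℝ) :
    T.normalizedError p s = T.error p := by
  simp [normalizedError, h]

end FullSimplex

theorem corollary3p1 (d : ℕ) (hd : 1 ≤ d) (p : ℝ≥0∞) (hp : 1 ≤ p)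
    (T₀ : FullSimplex d) (hreg : Affine.Simplex.Regular T₀) (hvol : FullSimplex.vol T₀ = 1) :
    (⨅ T : FullSimplex d, FullSimplex.normalizedError p (2 / (d : ℝ)) T) =
        FullSimplex.normalizedError p (2 / (d : ℝ)) T₀ ∧
      (⨅ (T : FullSimplex d) (_ : FullSimplex.vol T = 1), FullSimplex.normalizedError p 1 T) =
        FullSimplex.normalizedError p 1 T₀ := by
  have h := fun T : FullSimplex d =>
    FullSimplex.error_le_normalizedError hd hp T₀ T hreg.equilateral hvol
  refine ⟨le_antisymm (iInf_le _ T₀) (le_iInf fun T => ?_),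
    le_antisymm (iInf₂_le T₀ hvol) (le_iInf₂ fun T hT => ?_)⟩
  · rw [FullSimplex.normalizedError_of_vol_eq_one hvol]
    exact h T
  -- At unit volume the exponent is immaterial, so `1` may be traded for `2 / d`.
  · rw [FullSimplex.normalizedError_of_vol_eq_one hvol,
      FullSimplex.normalizedError_of_vol_eq_one hT,
      ← FullSimplex.normalizedError_of_vol_eq_one hT p (2 / (d : ℝ))]
    exact h T
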